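/- For a full subcategory $\mathcal C$ of the category of groups, a group $A$ and a subgroup $B\le A$, the dominion of $B$ in $A$ in $\mathcal C$ is $$\mathrm{dom}_A^{\mathcal C}(B)=\{a\in A : \text{for all } C\in\mathcal C \text{ and all homomorphisms } f,g\colon A\to C,\ f|_B=g|_B \text{ implies } f(a)=g(a)\}.$$ It contains $B$; for $A\in\mathcal C$ it is called nontrivial if it is different from $B$. Let $\mathcal N_c$ be the class of nilpotent groups of class at most $c$, $\mathcal Nil$ the class of all nilpotent groups, and $\mathcal A^2$ the class of metabelian groups (solvable of length at most two). Let $p$ be a prime, let $\mathbb Z[1/p]$ be the subring of $\mathbb Q$ generated by $\mathbb Z$ and $1/p$, and let $G$ be the group with underlying set $\mathbb Z[1/p]^3$ and multiplication $(a,b,c)\cdot(x,y,z)=(a+x,\;b+y,\;c+z+bx)$. Let $H$ be the subgroup of $G$ generated by $(1,0,0)$ and $(0,1,0)$. Then: 1. The map $(x,y,z)\mapsto\begin{pmatrix}1&y&z\\0&1&x\\0&0&1\end{pmatrix}$ is an isomorphism of $G$ onto the multiplicative group of upper unitriangular $3\times3$ matrices over $\mathbb Z[1/p]$, and $G\in\mathcal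 N_2$. 2. $H$ is the subgroup with underlying set $\mathbb Z\times\mathbb Z\times\mathbb Z$. 3. For every integer $c\ge 2$, $\mathrm{dom}_G^{\mathcal N_c}(H)$ is the subgroup with underlying set $\mathbb Z\times\mathbb Z\times\mathbb Z[1/p]$, and $\mathrm{dom}_G^{\mathcal Nil}(H)$ is this same subgroup. It properly contains $H$. 4. $\mathrm{dom}_G^{\mathcal A^2\cap\mathcal Nil}(H)$ also properly contains $H$. In particular, there are nontrivial dominions in $\mathcal Nil$ and in $\mathcal A^2\cap\mathcal Nil$. -/

import Mathlib

universe u v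

namespace Dominions

open CategoryTheory

/-- The dominion of the subgroup `H` of `A` in the full subcategory `𝒞` of the category of groups:
all `a` on which any two homomorphisms from `A` into a member of `𝒞` agree as soon as they
agree on `H`. -/
def dominion (𝒞 : ObjectProperty GrpCat.{v}) {A : Type u} [Group A] (H : Subgroup A) :
    Subgroup A where
  carrier := {a | ∀ K : GrpCat.{v}, 𝒞 K → ∀ f g : A →* K, (∀ h ∈ H, f h = g h) → f a = g a}
  one_mem' := fun K _ f g _ => by rw [map_one, map_one]
  mul_mem' := fun {a b} ha hb K hK f g hfg => by
    rw [map_mul, map_mul, ha K hK f g hfg, hb K hK f g hfg]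
  inv_mem' := fun {a} ha K hK f g hfg => by
    rw [map_inv, map_inv, ha K hK f g hfg]

/-- `𝒞` has nontrivial dominions: some subgroup of some member of `𝒞` differs from its dominion. -/
def HasNontrivialDominions (𝒞 : ObjectProperty GrpCat.{v}) : Prop :=
  ∃ A : GrpCat.{v}, 𝒞 A ∧ ∃ H : Subgroup A, dominion 𝒞 H ≠ H

/-- Nilpotent groups of class at most `c` (Mathlib's lower central series starts with the whole
group at index `0`). -/
def nilClass (c : ℕ) : ObjectProperty GrpCat.{v} :=
  fun K => Subgroup.lowerCentralSeries (⊤ : Subgroup K) c = ⊥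

/-- All nilpotent groups. -/
def nil : ObjectProperty GrpCat.{v} := fun K => Group.IsNilpotent K

/-- Metabelian groups: solvable of length at most two. -/
def metabelian : ObjectProperty GrpCat.{v} := fun K => derivedSeries K 2 = ⊥

/-- The subring `ℤ[1/p]` of `ℚ`. -/
def zInv (p : ℕ) : Subring ℚ := Subring.closure {(1 / p : ℚ)}

/-- Triples over `R`, with the multiplication
`(a, b, c) * (x, y, z) = (a + x, b + y, c + z + b * x)`. -/
@[ext]
structure Heis (R : Type u) where
  x : R
  y : R
  z : R

namespace Heis

variable {R : Type u} [CommRing R]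

instance : Mul (Heis R) := ⟨fun g h => ⟨g.x + h.x, g.y + h.y, g.z + h.z + g.y * h.x⟩⟩

instance : One (Heis R) := ⟨⟨0, 0, 0⟩⟩

instance : Inv (Heis R) := ⟨fun g => ⟨-g.x, -g.y, -g.z + g.y * g.x⟩⟩

theorem mul_def (g h : Heis R) :
    g * h = ⟨g.x + h.x, g.y + h.y, g.z + h.z + g.y * h.x⟩ := rfl

theorem one_def : (1 : Heis R) = ⟨0, 0, 0⟩ := rfl

theorem inv_def (g : Heis R) : g⁻¹ = ⟨-g.x, -g.y, -g.z + g.y * g.x⟩ := rfl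

instance : Group (Heis R) :=
  Group.ofLeftAxioms
    (fun a b c => by ext <;> simp only [mul_def] <;> ring)
    (fun a => by ext <;> simp only [mul_def, one_def] <;> ring)
    (fun a => by ext <;> simp only [mul_def, one_def, inv_def] <;> ring)

end Heis

/-- The subgroup generated by `(1, 0, 0)` and `(0, 1, 0)`. -/
def intHeis (R : Type u) [CommRing R] : Subgroup (Heis R) :=
  Subgroup.closure {⟨1, 0, 0⟩, ⟨0, 1, 0⟩}

end Dominions

namespace Dominions

open CategoryTheory
open scoped commutatorElement

/-! Upper bound: abelian targets suffice, since mapping either of the first two coordinates to `R/ℤ`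
kills `intHeis R`, hence its dominion. Lower bound: let `f`, `g` map a group with `n`-th roots to a
nilpotent group and agree at `b ^ n`. By induction on the class, `w = (g b)⁻¹ * f b` commutes with
the image of `f` (`commute_root_discrepancy`). If they also agree at `a`, then `w` cancels from `⁅f
b, f a⁆`, so they agree at `⁅b, a⁆` (`commutator_mem_dominion_nil`). In the Heisenberg group over
`ℤ[1/p]` such commutators fill the centre. Smaller classes of targets only enlarge the dominion. -/

/-! ### Roots in nilpotent groups -/

theorem commute_pow_of_commutator_central {K : Type*} [Group K] {x w : K} {n : ℕ}
    (h : ⁅x, w⁆ ∈ Subgroup.center K) (hw : w ^ n ∈ Subgroup.center K) : Commute (x ^ n) w := by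
  obtain ⟨z, hz⟩ : ∃ z, z = ⁅x, w⁆ := ⟨_, rfl⟩
  rw [← hz] at h
  have hzc : ∀ y, Commute z y := fun y => (Subgroup.mem_center_iff.mp h y).symm
  have h1 : x * w * x⁻¹ = z * w := by rw [hz, commutatorElement_def]; group
  have h2 : w * x * w⁻¹ = z⁻¹ * x := by rw [hz, commutatorElement_def]; group
  -- With `z` central, `z ^ n = ⁅x, w ^ n⁆ = 1`; likewise `⁅x ^ n, w⁆ = z ^ n`.
  have h3 : z ^ n = 1 := by
    have : x * w ^ n * x⁻¹ = z ^ n * w ^ n := by rw [← conj_pow, h1, (hzc w).mul_pow]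
    rw [Subgroup.mem_center_iff.mp hw x, mul_inv_cancel_right] at this
    exact (right_eq_mul.mp this)
  have h4 : w * x ^ n * w⁻¹ = x ^ n := by
    rw [← conj_pow, h2, (hzc x).inv_left.mul_pow, inv_pow, h3, inv_one, one_mul]
  exact (mul_inv_eq_iff_eq_mul.mp h4).symm

theorem commutator_mem_center_iff {K : Type*} [Group K] {x y : K} :
    ⁅x, y⁆ ∈ Subgroup.center K ↔
      Commute (QuotientGroup.mk' (Subgroup.center K) x) (QuotientGroup.mk' (Subgroup.center K) y) := by
  rw [← commutatorElement_eq_one_iff_commute, ← map_commutatorElement, ← MonoidHom.mem_ker,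
    QuotientGroup.ker_mk']

/-- In a nilpotent group, images of elements of a group with `n`-th roots commute with the
discrepancy between two `n`-th roots of one element. -/
theorem commute_root_discrepancy {G : Type*} [Group G] {n : ℕ}
    (hroot : ∀ a : G, ∃ b, b ^ n = a) (K : Type*) [Group K] [Group.IsNilpotent K] :
    ∀ (f g : G →* K) (b : G), f (b ^ n) = g (b ^ n) → ∀ a, Commute (f a) ((g b)⁻¹ * f b) := by
  refine Group.nilpotent_center_quotient_ind
    (P := fun K _ _ => ∀ (f g : G →* K) (b : G), f (b ^ n) = g (b ^ n) →
      ∀ a, Commute (f a) ((g b)⁻¹ * f b)) K ?_ ?_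
  · intro K _ _ f g b _ a
    exact Subsingleton.elim _ _
  · intro K _ _ ih f g b hb a
    let π := QuotientGroup.mk' (Subgroup.center K)
    have key : ∀ a, Commute (π (f a)) (π ((g b)⁻¹ * f b)) := fun a => by
      simpa using ih (π.comp f) (π.comp g) b (congrArg π hb) a
    have hw : ((g b)⁻¹ * f b) ^ n ∈ Subgroup.center K := by
      -- Modulo the centre the two factors commute, so comparing `n`-th powers kills the power of
      -- the discrepancy.
      have h1 : π (g b) = π (f b) * (π ((g b)⁻¹ * f b))⁻¹ := by
        simp only [map_mul, map_inv]; group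
      have h2 : π (g b) ^ n = π (f b) ^ n := by
        simp only [← map_pow, hb]
      rw [h1, (key b).inv_right.mul_pow, mul_eq_left, inv_pow, inv_eq_one, ← map_pow,
        ← MonoidHom.mem_ker, QuotientGroup.ker_mk'] at h2
      exact h2
    -- The induction hypothesis is used at an `n`-th root of the given element.
    obtain ⟨a, rfl⟩ := hroot a
    rw [map_pow]
    exact commute_pow_of_commutator_central (commutator_mem_center_iff.mpr (key a)) hw

theorem commutator_mem_dominion_nil {G : Type*} [Group G] {n : ℕ}
    (hroot : ∀ a : G, ∃ b, b ^ n = a) {H : Subgroup G} {a b : G} (ha : a ∈ H) (hb : b ^ n ∈ H) :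
    ⁅b, a⁆ ∈ dominion nil.{v} H := by
  intro K hK f g hfg
  have : Group.IsNilpotent K := hK
  have h := commute_root_discrepancy hroot K f g b (hfg _ hb) a
  have hu : f b = g b * ((g b)⁻¹ * f b) := by group
  generalize (g b)⁻¹ * f b = w at h hu
  rw [map_commutatorElement, map_commutatorElement, hu, ← hfg a ha]
  simp only [commutatorElement_def, mul_inv_rev]
  rw [mul_assoc (g b), ← h.eq]
  group

/-! ### Formal properties of dominions and nilpotency classes -/

theorem dominion_anti {𝒞 𝒟 : ObjectProperty GrpCat.{v}} (h : 𝒞 ≤ 𝒟) {A : Type u} [Group A]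
    (H : Subgroup A) : dominion 𝒟 H ≤ dominion 𝒞 H :=
  fun _ ha K hK => ha K (h K hK)

theorem le_dominion (𝒞 : ObjectProperty GrpCat.{v}) {A : Type u} [Group A]
    (H : Subgroup A) : H ≤ dominion 𝒞 H :=
  fun a ha _ _ _ _ hfg => hfg a ha

theorem nilClass_le_nil (c : ℕ) : nilClass.{v} c ≤ nil :=
  fun _ hK => Subgroup.nilpotent_iff_lowerCentralSeries.mpr ⟨c, hK⟩

theorem nilClass_mono {c d : ℕ} (h : c ≤ d) : nilClass.{v} c ≤ nilClass d :=
  fun _ hK => le_bot_iff.mp ((Subgroup.lowerCentralSeries_antitone _ h).trans hK.le)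

theorem nilClass_two_le_metabelian : nilClass.{v} 2 ≤ metabelian :=
  fun _ hK => le_bot_iff.mp ((Subgroup.derived_le_lower_central 2).trans hK.le)

theorem nilClass_one_of_comm (K : Type v) [CommGroup K] : nilClass 1 (GrpCat.of K) :=
  Subgroup.lowerCentralSeries_one_eq_bot_iff.mpr ⟨⟨mul_comm⟩⟩

theorem nilClass_ulift {c : ℕ} {G : Type u} [Group G] (h : nilClass c (GrpCat.of G)) :
    nilClass c (GrpCat.of (ULift.{v} G)) := by
  have h1 := Subgroup.map_lowerCentralSeries (S := ⊤) (MulEquiv.ulift.{u, v} (α := G)).toMonoidHom c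
  rw [Subgroup.map_top_of_surjective _ MulEquiv.ulift.surjective] at h1
  exact (Subgroup.map_eq_bot_iff_of_injective _ MulEquiv.ulift.injective).mp (h1.trans h)

theorem comap_dominion_le {𝒞 : ObjectProperty GrpCat.{v}} {A B : Type*} [Group A] [Group B]
    (e : A ≃* B) (H : Subgroup B) :
    (dominion 𝒞 H).comap e.toMonoidHom ≤ dominion 𝒞 (H.comap e.toMonoidHom) := by
  intro a ha K hK f g hfg
  have := ha K hK (f.comp e.symm.toMonoidHom) (g.comp e.symm.toMonoidHom)
    (fun h hh => hfg _ (by simpa using hh))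
  simpa using this

/-- The witness must live in the universe of the category, so `G` is replaced by its lift. -/
theorem hasNontrivialDominions_of_lt {𝒞 : ObjectProperty GrpCat.{max u v}} {G : Type u} [Group G]
    (h𝒞 : 𝒞 (GrpCat.of (ULift.{v} G))) {H : Subgroup G} (hH : H < dominion 𝒞 H) :
    HasNontrivialDominions 𝒞 := by
  obtain ⟨a, ha, haH⟩ := SetLike.exists_of_lt hH
  let e := MulEquiv.ulift.{u, v} (α := G)
  refine ⟨_, h𝒞, H.comap e.toMonoidHom, fun h => haH ?_⟩
  have : ULift.up a ∈ dominion 𝒞 (H.comap e.toMonoidHom) :=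
    comap_dominion_le e H (show e (ULift.up a) ∈ dominion 𝒞 H from ha)
  rw [h] at this
  exact this

theorem nilClass_two_of_commute {G : Type u} [Group G] (h : ∀ a b c : G, Commute ⁅a, b⁆ c) :
    nilClass 2 (GrpCat.of G) := by
  show (⁅⁅(⊤ : Subgroup G), ⊤⁆, ⊤⁆ : Subgroup G) = ⊥
  rw [Subgroup.commutator_eq_bot_iff_le_centralizer, Subgroup.commutator_le]
  exact fun a _ b _ => Subgroup.mem_centralizer_iff.mpr fun c _ => (h a b c).symm

/-! ### Arithmetic of the Heisenberg group -/

namespace Heis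

variable {R : Type u} [CommRing R]

theorem commutator_eq (g h : Heis R) : ⁅g, h⁆ = ⟨0, 0, g.y * h.x - h.y * g.x⟩ := by
  ext <;> simp only [commutatorElement_def, mul_def, inv_def] <;> ring

theorem nilClass_two : nilClass 2 (GrpCat.of (Heis R)) := by
  refine nilClass_two_of_commute fun a b c => ?_
  rw [commutator_eq]
  ext <;> simp only [mul_def] <;> ring

theorem pow_eq (g : Heis R) (n : ℕ) :
    g ^ n = ⟨n * g.x, n * g.y, n * g.z + n.choose 2 * (g.y * g.x)⟩ := by
  induction n with
  | zero => ext <;> simp [one_def]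
  | succ n ih =>
    rw [pow_succ, ih]
    ext <;> simp only [mul_def, Nat.choose_succ_succ' n 1, Nat.choose_one_right, Nat.cast_add,
      Nat.cast_one] <;> ring

theorem exists_pow_eq {n : ℕ} (hn : IsUnit (n : R)) (g : Heis R) : ∃ h, h ^ n = g := by
  obtain ⟨r, hr⟩ := hn.exists_right_inv
  -- Here `r` inverts `n`; the last entry solves the equation given by `pow_eq`.
  refine ⟨⟨r * g.x, r * g.y, r * (g.z - n.choose 2 * (r * g.y * (r * g.x)))⟩, ?_⟩
  rw [pow_eq]
  ext
  · linear_combination g.x * hr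
  · linear_combination g.y * hr
  · linear_combination (g.z - n.choose 2 * (r * g.y * (r * g.x))) * hr

/-- The embedding as upper unitriangular matrices. -/
def toSL : Heis R →* Matrix.SpecialLinearGroup (Fin 3) R where
  toFun g := ⟨!![1, g.y, g.z; 0, 1, g.x; 0, 0, 1], by simp [Matrix.det_fin_three]⟩
  map_one' := by
    ext i j
    fin_cases i <;> fin_cases j <;> simp [one_def]
  map_mul' g h := by
    refine Subtype.ext ?_
    change (!![1, (g * h).y, (g * h).z; 0, 1, (g * h).x; 0, 0, 1] : Matrix (Fin 3) (Fin 3) R) =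
      !![1, g.y, g.z; 0, 1, g.x; 0, 0, 1] * !![1, h.y, h.z; 0, 1, h.x; 0, 0, 1]
    ext i j
    fin_cases i <;> fin_cases j <;>
      simp [mul_def, Matrix.mul_apply, Fin.sum_univ_three, add_comm, add_assoc]

theorem toSL_coe (g : Heis R) :
    (toSL g : Matrix (Fin 3) (Fin 3) R) = !![1, g.y, g.z; 0, 1, g.x; 0, 0, 1] := rfl

theorem toSL_injective : Function.Injective (toSL (R := R)) := by
  intro g h hgh
  have H := fun i j => congrFun (congrFun (congrArg Subtype.val hgh) i) j
  simp only [toSL_coe] at H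
  ext
  · simpa using H 1 2
  · simpa using H 0 1
  · simpa using H 0 2

theorem range_toSL : Set.range (toSL (R := R)) =
    {M | (∀ i, M.1 i i = 1) ∧ ∀ i j, j < i → M.1 i j = 0} := by
  ext M
  constructor
  · rintro ⟨g, rfl⟩
    refine ⟨fun i => ?_, fun i j hij => ?_⟩
    · fin_cases i <;> simp [toSL_coe]
    · fin_cases i <;> fin_cases j <;> simp_all [toSL_coe]
  · rintro ⟨h1, h0⟩
    refine ⟨⟨M.1 1 2, M.1 0 1, M.1 0 2⟩, Subtype.ext ?_⟩
    ext i j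
    have a0 := h1 0
    have a1 := h1 1
    have a2 := h1 2
    have b1 := h0 1 0 (by decide)
    have b2 := h0 2 0 (by decide)
    have b3 := h0 2 1 (by decide)
    fin_cases i <;> fin_cases j <;> simp_all [toSL_coe]

/-- The product of the two generator powers, in this order, already contributes `b * a` to the last
coordinate. -/
theorem intCast_eq (a b : ℤ) (t : R) :
    (⟨a, b, t⟩ : Heis R) = ⟨0, 1, 0⟩ ^ b * ⟨1, 0, 0⟩ ^ a * ⟨0, 0, t - b * a⟩ := by
  have hx : ∀ n : ℤ, (⟨1, 0, 0⟩ : Heis R) ^ n = ⟨n, 0, 0⟩ := fun n => by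
    induction n using Int.induction_on with
    | zero => simp [one_def]
    | succ n ih => rw [zpow_add_one, ih]; simp [mul_def]
    | pred n ih => rw [zpow_sub_one, ih]; simp [mul_def, inv_def, sub_eq_add_neg]
  have hy : ∀ n : ℤ, (⟨0, 1, 0⟩ : Heis R) ^ n = ⟨0, n, 0⟩ := fun n => by
    induction n using Int.induction_on with
    | zero => simp [one_def]
    | succ n ih => rw [zpow_add_one, ih]; simp [mul_def]
    | pred n ih => rw [zpow_sub_one, ih]; simp [mul_def, inv_def, sub_eq_add_neg]
  rw [hx, hy]
  ext <;> simp [mul_def]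

theorem central_zpow (t : R) (k : ℤ) : (⟨0, 0, t⟩ : Heis R) ^ k = ⟨0, 0, k * t⟩ := by
  induction k using Int.induction_on with
  | zero => simp [one_def]
  | succ n ih => rw [zpow_add_one, ih]; ext <;> simp [mul_def]; ring
  | pred n ih => rw [zpow_sub_one, ih]; ext <;> simp [mul_def, inv_def]; ring

theorem mem_of_generators {S : Subgroup (Heis R)} (hS : intHeis R ≤ S) (a b : ℤ) {t : R}
    (ht : (⟨0, 0, t - b * a⟩ : Heis R) ∈ S) : (⟨a, b, t⟩ : Heis R) ∈ S := by
  rw [intCast_eq]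
  exact mul_mem (mul_mem (zpow_mem (hS (Subgroup.subset_closure (by simp))) _)
    (zpow_mem (hS (Subgroup.subset_closure (by simp))) _)) ht

theorem coe_intHeis : (intHeis R : Set (Heis R)) = {g | ∃ a b c : ℤ, g = ⟨a, b, c⟩} := by
  ext g
  constructor
  · intro hg
    induction hg using Subgroup.closure_induction with
    | mem g hg =>
      rcases hg with rfl | rfl
      · exact ⟨1, 0, 0, by simp⟩
      · exact ⟨0, 1, 0, by simp⟩
    | one => exact ⟨0, 0, 0, by simp [one_def]⟩
    | mul g h _ _ hg hh =>
      obtain ⟨a, b, c, rfl⟩ := hg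
      obtain ⟨x, y, z, rfl⟩ := hh
      exact ⟨a + x, b + y, c + z + b * x, by simp [mul_def]⟩
    | inv g _ hg =>
      obtain ⟨a, b, c, rfl⟩ := hg
      exact ⟨-a, -b, -c + b * a, by simp [inv_def]⟩
  · rintro ⟨a, b, c, rfl⟩
    refine mem_of_generators le_rfl a b ?_
    have h1 : (⁅(⟨0, 1, 0⟩ : Heis R), ⟨1, 0, 0⟩⁆ : Heis R) ∈ intHeis R :=
      Subgroup.commutator_le.mp (Subgroup.commutator_le_self _) _
        (Subgroup.subset_closure (by simp)) _ (Subgroup.subset_closure (by simp))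
    rw [commutator_eq] at h1
    have h2 := zpow_mem h1 (c - b * a)
    rw [central_zpow] at h2
    simpa using h2

/-- The first coordinate as a homomorphism. -/
def xHom : Heis R →* Multiplicative R where
  toFun g := Multiplicative.ofAdd g.x
  map_one' := rfl
  map_mul' _ _ := rfl

/-- The second coordinate as a homomorphism. -/
def yHom : Heis R →* Multiplicative R where
  toFun g := Multiplicative.ofAdd g.y
  map_one' := rfl
  map_mul' _ _ := rfl

end Heis

/-! ### Bounds on the dominion -/

/-- Compare `f`, lifted to the right universe, with the trivial homomorphism. -/
theorem dominion_le_ker {𝒞 : ObjectProperty GrpCat.{max u v}} (h𝒞 : nilClass 1 ≤ 𝒞) {A : Type*}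
    [Group A] {K : Type u} [CommGroup K] (H : Subgroup A) (f : A →* K) (hf : H ≤ f.ker) :
    dominion 𝒞 H ≤ f.ker := by
  intro a ha
  have e := MulEquiv.ulift.{u, v} (α := K)
  have := ha (GrpCat.of (ULift.{v} K)) (h𝒞 _ (nilClass_one_of_comm _))
    (e.symm.toMonoidHom.comp f) 1 (fun h hh => by simp [MonoidHom.mem_ker.mp (hf hh)])
  simpa using this

namespace Heis

variable {R : Type u} [CommRing R]

theorem dominion_subset {𝒞 : ObjectProperty GrpCat.{max u v}} (h𝒞 : nilClass 1 ≤ 𝒞) :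
    (dominion 𝒞 (intHeis R) : Set (Heis R)) ⊆ {g | ∃ (a b : ℤ) (t : R), g = ⟨a, b, t⟩} := by
  let π : Multiplicative R →* Multiplicative (R ⧸ (Int.castAddHom R).range) :=
    AddMonoidHom.toMultiplicative (QuotientAddGroup.mk' _)
  have hπ : ∀ r : R, π (Multiplicative.ofAdd r) = 1 ↔ ∃ n : ℤ, (n : R) = r := fun r =>
    (QuotientAddGroup.eq_zero_iff r).trans Iff.rfl
  intro g hg
  have h1 := dominion_le_ker.{u, v} h𝒞 (intHeis R) (π.comp xHom) (fun h hh => by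
    obtain ⟨a, b, c, rfl⟩ := coe_intHeis.subset hh
    exact (hπ _).mpr ⟨a, rfl⟩) hg
  have h2 := dominion_le_ker.{u, v} h𝒞 (intHeis R) (π.comp yHom) (fun h hh => by
    obtain ⟨a, b, c, rfl⟩ := coe_intHeis.subset hh
    exact (hπ _).mpr ⟨b, rfl⟩) hg
  obtain ⟨a, ha⟩ := (hπ g.x).mp h1
  obtain ⟨b, hb⟩ := (hπ g.y).mp h2
  exact ⟨a, b, g.z, by rw [ha, hb]⟩

theorem subset_dominion_nil
    (hR : ∀ t : R, ∃ (n : ℕ) (k : ℤ), IsUnit (n : R) ∧ n * t = k) :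
    {g | ∃ (a b : ℤ) (t : R), g = ⟨a, b, t⟩} ⊆
      (dominion nil.{v} (intHeis R) : Set (Heis R)) := by
  rintro _ ⟨a, b, t, rfl⟩
  refine mem_of_generators (le_dominion _ _) a b ?_
  obtain ⟨n, k, hn, hk⟩ := hR (t - b * a)
  have hx : (⟨1, 0, 0⟩ : Heis R) ∈ intHeis R := Subgroup.subset_closure (by simp)
  have hy : (⟨0, t - b * a, 0⟩ : Heis R) ^ n ∈ intHeis R := by
    rw [pow_eq, ← SetLike.mem_coe, coe_intHeis]
    exact ⟨0, k, 0, by simp [hk]⟩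
  -- With `s = t - b * a`, the element `(0, 0, s)` is the commutator of `(0, s, 0)` and `(1, 0, 0)`.
  have h := commutator_mem_dominion_nil (exists_pow_eq hn) hx hy
  simpa [commutator_eq] using h

end Heis

/-! ### Denominators in `ℤ[1/p]` -/

theorem exists_pow_mul_eq_intCast {p : ℕ} (hp : p ≠ 0) (t : zInv p) :
    ∃ (n : ℕ) (k : ℤ), ((p ^ n : ℕ) : zInv p) * t = k := by
  have hp' : (p : ℚ) ≠ 0 := Nat.cast_ne_zero.mpr hp
  obtain ⟨t, ht⟩ := t
  suffices ∃ (n : ℕ) (k : ℤ), (p : ℚ) ^ n * t = k by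
    obtain ⟨n, k, h⟩ := this
    exact ⟨n, k, Subtype.ext (by simpa using h)⟩
  induction ht using Subring.closure_induction with
  | mem x hx => rw [hx]; exact ⟨1, 1, by simp [hp']⟩
  | zero => exact ⟨0, 0, by simp⟩
  | one => exact ⟨0, 1, by simp⟩
  | add x y _ _ hx hy =>
    obtain ⟨n, k, h⟩ := hx
    obtain ⟨m, l, h'⟩ := hy
    exact ⟨n + m, p ^ m * k + p ^ n * l, by push_cast; rw [← h, ← h']; ring⟩
  | neg x _ hx =>
    obtain ⟨n, k, h⟩ := hx
    exact ⟨n, -k, by push_cast; rw [← h]; ring⟩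
  | mul x y _ _ hx hy =>
    obtain ⟨n, k, h⟩ := hx
    obtain ⟨m, l, h'⟩ := hy
    exact ⟨n + m, k * l, by push_cast; rw [← h, ← h']; ring⟩

theorem mul_inv_p {p : ℕ} (hp : p ≠ 0) :
    (p : zInv p) * ⟨1 / p, Subring.subset_closure rfl⟩ = 1 :=
  Subtype.ext (by simp [hp])

theorem intHeis_lt {p : ℕ} (hp : p.Prime) {S : Subgroup (Heis (zInv p))}
    (hS : {g | ∃ (a b : ℤ) (t : zInv p), g = ⟨a, b, t⟩} ⊆ (S : Set (Heis (zInv p)))) :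
    intHeis (zInv p) < S := by
  refine lt_of_le_of_ne (fun g hg => ?_) fun h => ?_
  · obtain ⟨a, b, c, rfl⟩ := Heis.coe_intHeis.subset hg
    exact hS ⟨a, b, c, rfl⟩
  -- If equality held, `1 / p` would be an integer, making `p` a unit of `ℤ`.
  · have h1 := hS ⟨0, 0, ⟨1 / p, Subring.subset_closure rfl⟩, rfl⟩
    rw [← h, Heis.coe_intHeis] at h1
    obtain ⟨a, b, c, hc⟩ := h1
    have h2 : (p : zInv p) * c = 1 := by
      have hz : _ = (c : zInv p) := congrArg Heis.z hc
      rw [← hz]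
      exact mul_inv_p hp.ne_zero
    have h3 : (p : ℤ) * c = 1 := by exact_mod_cast congrArg Subtype.val h2
    exact (Nat.prime_iff_prime_int.mp hp).not_isUnit (.of_mul_eq_one _ h3)

end Dominions


theorem mainTheorem9 (p : ℕ) (hp : p.Prime) :
    -- the group is the group of upper unitriangular matrices over `ℤ[1/p]`
    (∃ φ : Dominions.Heis (Dominions.zInv p) →*
          Matrix.SpecialLinearGroup (Fin 3) (Dominions.zInv p),
        Function.Injective φ ∧
        (∀ g, (φ g : Matrix (Fin 3) (Fin 3) (Dominions.zInv p)) =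
          !![1, g.y, g.z; 0, 1, g.x; 0, 0, 1]) ∧
        Set.range φ = {M | (∀ i, M.1 i i = 1) ∧ ∀ i j, j < i → M.1 i j = 0}) ∧
    -- it is nilpotent of class at most two
    Dominions.nilClass 2 (GrpCat.of (Dominions.Heis (Dominions.zInv p))) ∧
    -- the underlying set of the subgroup is `ℤ × ℤ × ℤ`
    (Dominions.intHeis (Dominions.zInv p) : Set (Dominions.Heis (Dominions.zInv p))) =
      {g | ∃ a b c : ℤ, g = ⟨a, b, c⟩} ∧
    -- its dominions for all class bounds, and among all nilpotent groups, are `ℤ × ℤ × ℤ[1/p]`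
    (∀ c : ℕ, 2 ≤ c →
      (Dominions.dominion (Dominions.nilClass.{v} c) (Dominions.intHeis (Dominions.zInv p)) :
          Set (Dominions.Heis (Dominions.zInv p))) =
        {g | ∃ (a b : ℤ) (t : Dominions.zInv p), g = ⟨a, b, t⟩}) ∧
    (Dominions.dominion Dominions.nil.{v} (Dominions.intHeis (Dominions.zInv p)) :
        Set (Dominions.Heis (Dominions.zInv p))) =
      {g | ∃ (a b : ℤ) (t : Dominions.zInv p), g = ⟨a, b, t⟩} ∧
    -- they properly contain the subgroup
    (∀ c : ℕ, 2 ≤ c → Dominions.intHeis (Dominions.zInv p) <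
      Dominions.dominion (Dominions.nilClass.{v} c) (Dominions.intHeis (Dominions.zInv p))) ∧
    Dominions.intHeis (Dominions.zInv p) <
      Dominions.dominion Dominions.nil.{v} (Dominions.intHeis (Dominions.zInv p)) ∧
    -- and so does the dominion among all metabelian nilpotent groups
    Dominions.intHeis (Dominions.zInv p) <
      Dominions.dominion (Dominions.metabelian.{v} ⊓ Dominions.nil.{v})
        (Dominions.intHeis (Dominions.zInv p)) ∧
    -- so both categories have nontrivial dominions
    Dominions.HasNontrivialDominions Dominions.nil.{v} ∧
    Dominions.HasNontrivialDominions (Dominions.metabelian.{v} ⊓ Dominions.nil.{v}) := by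

  have hp0 := hp.ne_zero
  have hunit : IsUnit (p : Dominions.zInv p) := .of_mul_eq_one _ (Dominions.mul_inv_p hp0)
  have hnil := Dominions.Heis.subset_dominion_nil.{0, v} (R := Dominions.zInv p) (fun t => by
    obtain ⟨n, k, h⟩ := Dominions.exists_pow_mul_eq_intCast hp0 t
    exact ⟨p ^ n, k, by rw [Nat.cast_pow]; exact hunit.pow n, h⟩)
  have hclass := fun c => hnil.trans
    (Dominions.dominion_anti (Dominions.nilClass_le_nil.{v} c) (Dominions.intHeis _))
  have hmet := hnil.trans (Dominions.dominion_anti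
    (inf_le_right : Dominions.metabelian.{v} ⊓ Dominions.nil.{v} ≤ _) (Dominions.intHeis _))
  have htwo := Dominions.nilClass_ulift.{0, v} (Dominions.Heis.nilClass_two (R := Dominions.zInv p))
  refine ⟨⟨Dominions.Heis.toSL, Dominions.Heis.toSL_injective, Dominions.Heis.toSL_coe,
    Dominions.Heis.range_toSL⟩, Dominions.Heis.nilClass_two, Dominions.Heis.coe_intHeis,
    fun c hc => (Dominions.Heis.dominion_subset.{0, v}
      (Dominions.nilClass_mono (by omega))).antisymm (hclass c),
    (Dominions.Heis.dominion_subset.{0, v} (Dominions.nilClass_le_nil 1)).antisymm hnil,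
    fun c _ => Dominions.intHeis_lt hp (hclass c), Dominions.intHeis_lt hp hnil,
    Dominions.intHeis_lt hp hmet, ?_, ?_⟩
  · exact Dominions.hasNontrivialDominions_of_lt.{0, v} (Dominions.nilClass_le_nil 2 _ htwo)
      (Dominions.intHeis_lt hp hnil)
  · exact Dominions.hasNontrivialDominions_of_lt.{0, v}
      ⟨Dominions.nilClass_two_le_metabelian _ htwo, Dominions.nilClass_le_nil 2 _ htwo⟩
      (Dominions.intHeis_lt hp hmet)
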